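/- **Proposition (nullspace property).** Write $[p]=\{1,\dots,p\}$. A set $\Omega\subseteq[p]\times[p]$ is called $d$-distributed if every row $\{i\}\times[p]$ and every column $[p]\times\{i\}$ contains at most $d$ elements of $\Omega$ (it is allowed, but not required, that $\Omega$ contains the diagonal). For $V\in\mathbb{R}^{p\times p}$ let $\|V\|_1=\sum_{i,j}|V_{ij}|$, and let $V_\Omega$ be the matrix that agrees with $V$ on $\Omega$ and is $0$ elsewhere; $\Omega^c=([p]\times[p])\setminus\Omega$. A uniformly random $\delta$-left regular bipartite graph with left set $[p]$ and right set $[m]$ is obtained by choosing, for each $i\in[p]$, $\delta$ right endpoints in $[m]$ uniformly and independently (with replacement, independently over $i$). Its adjacency matrix $A\in\mathbb{R}^{m\times p}$ is either the matrix whose entry $A_{ji}$ is the number of edges between $i$ and $j$ (multigraph convention), or the $\{0,1\}$-matrix with $A_{ji}=1$ if and only if $i$ and $j$ are joined by at least one edge. There are absolute constants $\varepsilon\in(0,\tfrac14)$, $c>0$ and $C_0>0$ such that for every $C_1\ge C_0$ there is a constant $K>0$, depending only on $C_1$, for which the following holds. Let $p\ge 2$, $d\ge 1$, $\delta$, $m$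 be integers with $$C_0\log p\le\delta\le C_1\log p,\qquad m\ge K\sqrt{dp}\,\log p,$$ and let $\Omega\subseteq[p]\times[p]$ be a fixed $d$-distributed set. Then, for each of the two conventions for $A$, with probability exceeding $1-p^{-c}$, every $V\in\mathbb{R}^{p\times p}$ with $AVA^T=0$ satisfies $$\|V_\Omega\|_1\le\frac{\varepsilon}{1-3\varepsilon}\,\|V_{\Omega^c}\|_1 .$$ In particular this holds for $\delta=\Theta(\log p)$ with a large enough lower constant and $m=\lceil K\sqrt{dp}\,\log p\rceil=\mathcal{O}(\sqrt{dp}\,\log p)$. -/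

import Mathlib

namespace CovSketch

/-- The collection of all `d`-distributed subsets `Ω ⊆ [p] × [p]`: every row and every column of
`[p] × [p]` contains at most `d` elements of `Ω`. The diagonal is not required to lie in `Ω`;
the sets that do contain it form a subfamily. -/
def distributedSets (d p : ℕ) : Set (Finset (Fin p × Fin p)) :=
  {Ω | ∀ i : Fin p, (Ω.filter fun x => x.1 = i).card ≤ d ∧ (Ω.filter fun x => x.2 = i).card ≤ d}

/-- The outcomes of the random choices: `e i k` is the right endpoint in `[m]` of the `k`-th edge
leaving the left vertex `i ∈ [p]`, so that each left vertex has `δ` edges. -/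
abbrev EdgeChoice (p m δ : ℕ) : Type := Fin p → Fin δ → Fin m

/-- The law of a uniformly random `δ`-left regular bipartite graph on `[p]` and `[m]`: all
`p * δ` right endpoints are chosen independently and uniformly from `[m]`, with replacement.
Equivalently, all elements of the finite set `EdgeChoice p m δ` are equally likely. -/
noncomputable def randomGraph (p m δ : ℕ) : MeasureTheory.Measure (EdgeChoice p m δ) :=
  ProbabilityTheory.uniformOn Set.univ

theorem isProbabilityMeasure_randomGraph (p m δ : ℕ) (hm : 0 < m) :
    MeasureTheory.IsProbabilityMeasure (randomGraph p m δ) := by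
  have : Nonempty (Fin m) := ⟨⟨0, hm⟩⟩
  exact ProbabilityTheory.isProbabilityMeasure_uniformOn Set.finite_univ Set.univ_nonempty

/-- The `m × p` adjacency matrix of the multigraph: the entry at `(j, i)` is the number of edges
between the left vertex `i` and the right vertex `j`. -/
def multiAdj {p m δ : ℕ} (e : EdgeChoice p m δ) : Matrix (Fin m) (Fin p) ℝ :=
  Matrix.of fun j i => ((Finset.univ.filter fun k : Fin δ => e i k = j).card : ℝ)

/-- The `m × p` adjacency matrix, with entries in `{0, 1}`, of the underlying simple bipartite
graph: the entry at `(j, i)` is `1` exactly when some edge joins `i` and `j`. -/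
noncomputable def simpleAdj {p m δ : ℕ} (e : EdgeChoice p m δ) : Matrix (Fin m) (Fin p) ℝ :=
  Matrix.of fun j i => if ∃ k : Fin δ, e i k = j then 1 else 0

/-- The entrywise `ℓ₁` norm of a matrix, that is, the `ℓ₁` norm of its vectorization. -/
def l1Norm {p : ℕ} (X : Matrix (Fin p) (Fin p) ℝ) : ℝ :=
  ∑ i, ∑ j, |X i j|

/-- The projection `X_Ω` of `X` onto the matrices supported on `Ω`. -/
def proj {p : ℕ} (Ω : Finset (Fin p × Fin p)) (X : Matrix (Fin p) (Fin p) ℝ) :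
    Matrix (Fin p) (Fin p) ℝ :=
  Matrix.of fun i j => if (i, j) ∈ Ω then X i j else 0

/-- The nullspace property of the map `V ↦ A V Aᵀ` with respect to `Ω`:
every real matrix `V` with `A V Aᵀ = 0` satisfies
`‖V_Ω‖₁ ≤ ε / (1 - 3 ε) * ‖V_{Ωᶜ}‖₁`. -/
def NullspaceProperty {p m : ℕ} (ε : ℝ) (Ω : Finset (Fin p × Fin p))
    (A : Matrix (Fin m) (Fin p) ℝ) : Prop :=
  ∀ V : Matrix (Fin p) (Fin p) ℝ, A * V * A.transpose = 0 →
    l1Norm (proj Ω V) ≤ ε / (1 - 3 * ε) * l1Norm (proj Ωᶜ V)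

end CovSketch

/-! Square the graph as a tensor product: (i, i') is joined to every pair formed by an endpoint of
an edge at i and one at i'. At a private neighbour of g ∈ Ω, adjacent to no other element of Ω, the
equation A V Aᵀ = 0 bounds |V_g| by weighted entries off Ω (`abs_le_sum_compl_of_private`). If each
g has at least δ²/2 private neighbours and each h off Ω sends at most δ²/4 of its δ² edge pairs into
the neighbourhood of Ω, summation gives ‖V_Ω‖₁ ≤ ½ ‖V_{Ωᶜ}‖₁ (`nullspaceProperty_of_expansion`).

Edge pairs are not independent, so the edges are resampled one left vertex at a time. With the other
vertices fixed, the edges at i hit a set of size at most m/`base` more than δ/12 times with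
probability at most 256^(-δ) (`card_many_hits_le`). Collisions at (i, i') are caught by such sets
(`collisions_subset`): neighbourhoods of at most d + 1 vertices, and sections of the set of at most
pdδ² far pairs. Few sections are heavy because pdδ² is small against m²; this is where m of order
√(dp) δ enters. A union bound concludes. -/

namespace CovSketch

/-! ### Private neighbours and collisions in the tensor graph -/

/-- The right neighbourhood of the left vertex `i`. -/
def nbhd {p m δ : ℕ} (e : EdgeChoice p m δ) (i : Fin p) : Finset (Fin m) :=
  Finset.univ.image (e i)

theorem mem_nbhd {p m δ : ℕ} {e : EdgeChoice p m δ} {i : Fin p} {j : Fin m} :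
    j ∈ nbhd e i ↔ ∃ k, e i k = j := by
  simp [nbhd]

theorem card_nbhd_le {p m δ : ℕ} (e : EdgeChoice p m δ) (i : Fin p) : (nbhd e i).card ≤ δ := by
  simpa [nbhd] using Finset.card_image_le (s := Finset.univ) (f := e i)

/-- The vertices of the tensor graph adjacent to an element of `Ω` other than `g`. -/
def coveredBy {p m δ : ℕ} (e : EdgeChoice p m δ) (Ω : Finset (Fin p × Fin p))
    (g : Fin p × Fin p) : Finset (Fin m × Fin m) :=
  (Ω.erase g).biUnion fun h => nbhd e h.1 ×ˢ nbhd e h.2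

theorem mem_coveredBy {p m δ : ℕ} {e : EdgeChoice p m δ} {Ω : Finset (Fin p × Fin p)}
    {g : Fin p × Fin p} {x : Fin m × Fin m} :
    x ∈ coveredBy e Ω g ↔ ∃ h, h ≠ g ∧ h ∈ Ω ∧ x.1 ∈ nbhd e h.1 ∧ x.2 ∈ nbhd e h.2 := by
  simp only [coveredBy, Finset.mem_biUnion, Finset.mem_erase, Finset.mem_product, and_assoc]

/-- The edges of the tensor graph at `g` whose endpoint is also adjacent to an element of `Ω`
other than `g`. -/
def collisions {p m δ : ℕ} (e : EdgeChoice p m δ) (Ω : Finset (Fin p × Fin p))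
    (g : Fin p × Fin p) : Finset (Fin δ × Fin δ) :=
  Finset.univ.filter fun k => (e g.1 k.1, e g.2 k.2) ∈ coveredBy e Ω g

/-- The vertices of the tensor graph adjacent to `g` and to no other element of `Ω`. -/
def privateNbhd {p m δ : ℕ} (e : EdgeChoice p m δ) (Ω : Finset (Fin p × Fin p))
    (g : Fin p × Fin p) : Finset (Fin m × Fin m) :=
  (nbhd e g.1 ×ˢ nbhd e g.2) \ coveredBy e Ω g

/-- Each neighbour of `g` that is not private is the endpoint of at least one collision. -/
theorem card_mul_card_le_private_add_collisions {p m δ : ℕ} (e : EdgeChoice p m δ)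
    (Ω : Finset (Fin p × Fin p)) (g : Fin p × Fin p) :
    (nbhd e g.1).card * (nbhd e g.2).card ≤
      (privateNbhd e Ω g).card + (collisions e Ω g).card := by
  rw [← Finset.card_product]
  have h : nbhd e g.1 ×ˢ nbhd e g.2 ⊆ privateNbhd e Ω g ∪
      (collisions e Ω g).image fun k => (e g.1 k.1, e g.2 k.2) := by
    rintro ⟨j, j'⟩ hx
    by_cases hc : (j, j') ∈ coveredBy e Ω g
    · obtain ⟨h1, h2⟩ := Finset.mem_product.1 hx
      obtain ⟨k, rfl⟩ := mem_nbhd.1 h1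
      obtain ⟨k', rfl⟩ := mem_nbhd.1 h2
      refine Finset.mem_union_right _ (Finset.mem_image.2 ⟨(k, k'), ?_, rfl⟩)
      simpa [collisions] using hc
    · exact Finset.mem_union_left _ (Finset.mem_sdiff.2 ⟨hx, hc⟩)
  exact (Finset.card_le_card h).trans <| (Finset.card_union_le _ _).trans <|
    Nat.add_le_add_left Finset.card_image_le _

theorem disjoint_privateNbhd {p m δ : ℕ} (e : EdgeChoice p m δ) {Ω : Finset (Fin p × Fin p)}
    {g h : Fin p × Fin p} (hg : g ∈ Ω) (hgh : g ≠ h) :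
    Disjoint (privateNbhd e Ω g) (privateNbhd e Ω h) := by
  rw [Finset.disjoint_left]
  rintro x hx hx'
  rw [privateNbhd, Finset.mem_sdiff, Finset.mem_product] at hx hx'
  exact hx'.2 (mem_coveredBy.2 ⟨g, hgh, hg, hx.1⟩)

/-- Sort the collisions by endpoint: each fibre is a product of two sets of edges, counted by
entries of `multiAdj`. Collisions are counted as edges, not vertices, so that one bound serves both
conventions for A. -/
theorem sum_multiAdj_coveredBy {p m δ : ℕ} (e : EdgeChoice p m δ) (Ω : Finset (Fin p × Fin p))
    (g : Fin p × Fin p) :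
    ∑ x ∈ coveredBy e Ω g, multiAdj e x.1 g.1 * multiAdj e x.2 g.2 =
      ((collisions e Ω g).card : ℝ) := by
  have h := Finset.card_eq_sum_card_fiberwise (s := collisions e Ω g) (t := coveredBy e Ω g)
    (f := fun k => (e g.1 k.1, e g.2 k.2)) (fun k hk => by simpa [collisions] using hk)
  rw [h, Nat.cast_sum]
  refine Finset.sum_congr rfl fun x hx => ?_
  simp only [multiAdj, Matrix.of_apply]
  rw [← Nat.cast_mul, ← Finset.card_product]
  congr 2
  ext k
  simp only [collisions, Finset.mem_product, Finset.mem_filter, Finset.mem_univ, true_and]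
  constructor
  · rintro ⟨h1, h2⟩
    rw [h1, h2]
    exact ⟨hx, rfl⟩
  · rintro ⟨-, rfl⟩
    exact ⟨rfl, rfl⟩

theorem one_le_of_mem_nbhd {p m δ : ℕ} {e : EdgeChoice p m δ} {A : Matrix (Fin m) (Fin p) ℝ}
    (hs : ∀ j i, simpleAdj e j i ≤ A j i) {j : Fin m} {i : Fin p} (h : j ∈ nbhd e i) :
    1 ≤ A j i := by
  refine le_trans (le_of_eq ?_) (hs j i)
  rw [simpleAdj, Matrix.of_apply, if_pos (mem_nbhd.1 h)]

theorem multiAdj_eq_zero {p m δ : ℕ} {e : EdgeChoice p m δ} {j : Fin m} {i : Fin p}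
    (h : j ∉ nbhd e i) : multiAdj e j i = 0 := by
  rw [mem_nbhd, not_exists] at h
  simp [multiAdj, h]

theorem simpleAdj_nonneg {p m δ : ℕ} (e : EdgeChoice p m δ) (j : Fin m) (i : Fin p) :
    0 ≤ simpleAdj e j i := by
  rw [simpleAdj, Matrix.of_apply]
  split_ifs <;> norm_num

theorem simpleAdj_le_multiAdj {p m δ : ℕ} (e : EdgeChoice p m δ) (j : Fin m) (i : Fin p) :
    simpleAdj e j i ≤ multiAdj e j i := by
  rw [simpleAdj, Matrix.of_apply, multiAdj, Matrix.of_apply]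
  split_ifs with h
  · obtain ⟨k, hk⟩ := h
    exact_mod_cast Finset.card_pos.2 ⟨k, by simpa using hk⟩
  · positivity

/-! ### Expansion implies the nullspace property -/

theorem l1Norm_proj {p : ℕ} (Ω : Finset (Fin p × Fin p)) (V : Matrix (Fin p) (Fin p) ℝ) :
    l1Norm (proj Ω V) = ∑ g ∈ Ω, |V g.1 g.2| := by
  rw [l1Norm, ← Fintype.sum_prod_type (f := fun g : Fin p × Fin p => |proj Ω V g.1 g.2|),
    ← Finset.sum_subset (Finset.subset_univ Ω)]
  · exact Finset.sum_congr rfl fun g hg => by simp [proj, hg]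
  · exact fun g _ hg => by simp [proj, hg]

/-- On a private neighbour of `g ∈ Ω`, the equation `A V Aᵀ = 0` bounds the contribution of `g`
by the contributions of the complement of `Ω`. -/
theorem abs_le_sum_compl_of_private {p m δ : ℕ} {e : EdgeChoice p m δ}
    {Ω : Finset (Fin p × Fin p)} {A : Matrix (Fin m) (Fin p) ℝ}
    (hs : ∀ j i, simpleAdj e j i ≤ A j i) (hm : ∀ j i, A j i ≤ multiAdj e j i)
    {V : Matrix (Fin p) (Fin p) ℝ} (hV : A * V * A.transpose = 0)
    {g : Fin p × Fin p} (hg : g ∈ Ω) {x : Fin m × Fin m} (hx : x ∈ privateNbhd e Ω g) :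
    |V g.1 g.2| ≤ ∑ h ∈ Ωᶜ, A x.1 h.1 * A x.2 h.2 * |V h.1 h.2| := by
  have hA : ∀ j i, 0 ≤ A j i := fun j i => (simpleAdj_nonneg e j i).trans (hs j i)
  have hA0 : ∀ j i, j ∉ nbhd e i → A j i = 0 := fun j i h =>
    le_antisymm ((hm j i).trans (multiAdj_eq_zero h).le) (hA j i)
  have hsum : ∑ h : Fin p × Fin p, A x.1 h.1 * A x.2 h.2 * V h.1 h.2 = 0 := by
    have := congrFun (congrFun hV x.1) x.2
    rw [Matrix.mul_apply] at this
    simp only [Matrix.mul_apply, Matrix.transpose_apply, Matrix.zero_apply, Finset.sum_mul] at this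
    rw [← this, Fintype.sum_prod_type, Finset.sum_comm]
    exact Finset.sum_congr rfl fun i _ => Finset.sum_congr rfl fun j _ => by ring
  rw [privateNbhd, Finset.mem_sdiff, Finset.mem_product] at hx
  have hΩ : ∑ h ∈ Ω, A x.1 h.1 * A x.2 h.2 * V h.1 h.2 = A x.1 g.1 * A x.2 g.2 * V g.1 g.2 := by
    refine Finset.sum_eq_single_of_mem g hg fun h hh hne => ?_
    by_cases h1 : x.1 ∈ nbhd e h.1
    · by_cases h2 : x.2 ∈ nbhd e h.2
      · exact absurd (mem_coveredBy.2 ⟨h, hne, hh, h1, h2⟩) hx.2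
      · rw [hA0 _ _ h2]; ring
    · rw [hA0 _ _ h1]; ring
  rw [← Finset.sum_add_sum_compl Ω, hΩ] at hsum
  have h1 := one_le_of_mem_nbhd hs hx.1.1
  have h2 := one_le_of_mem_nbhd hs hx.1.2
  calc |V g.1 g.2| ≤ A x.1 g.1 * A x.2 g.2 * |V g.1 g.2| :=
        le_mul_of_one_le_left (abs_nonneg _) (one_le_mul_of_one_le_of_one_le h1 h2)
    _ = |∑ h ∈ Ωᶜ, A x.1 h.1 * A x.2 h.2 * V h.1 h.2| := by
        rw [eq_neg_of_add_eq_zero_right hsum, abs_neg, abs_mul,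
          abs_of_nonneg (mul_nonneg (hA _ _) (hA _ _))]
    _ ≤ ∑ h ∈ Ωᶜ, |A x.1 h.1 * A x.2 h.2 * V h.1 h.2| := Finset.abs_sum_le_sum_abs _ _
    _ = _ := Finset.sum_congr rfl fun h _ => by
        rw [abs_mul, abs_of_nonneg (mul_nonneg (hA _ _) (hA _ _))]

/-- Expansion of the tensor graph around `Ω` implies the nullspace property. -/
theorem nullspaceProperty_of_expansion {p m δ : ℕ} (hδ : 0 < δ) {e : EdgeChoice p m δ}
    {Ω : Finset (Fin p × Fin p)} (hdeg : ∀ i, 11 * δ ≤ 12 * (nbhd e i).card)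
    (hcol : ∀ g, 4 * (collisions e Ω g).card ≤ δ ^ 2) {A : Matrix (Fin m) (Fin p) ℝ}
    (hs : ∀ j i, simpleAdj e j i ≤ A j i) (hm : ∀ j i, A j i ≤ multiAdj e j i) :
    NullspaceProperty (1 / 5) Ω A := by
  intro V hV
  rw [l1Norm_proj, l1Norm_proj]
  have hA : ∀ j i, 0 ≤ A j i := fun j i => (simpleAdj_nonneg e j i).trans (hs j i)
  have hδ' : (0 : ℝ) < (δ : ℝ) ^ 2 := by positivity
  have hpriv : ∀ g, 1 / 2 * (δ : ℝ) ^ 2 ≤ (privateNbhd e Ω g).card := by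
    intro g
    have h1 := card_mul_card_le_private_add_collisions e Ω g
    have h2 := hcol g
    have h3 := Nat.mul_le_mul (hdeg g.1) (hdeg g.2)
    have h4 : (11 * δ) * (11 * δ) = 121 * δ ^ 2 := by ring
    have h5 : 12 * (nbhd e g.1).card * (12 * (nbhd e g.2).card) =
      144 * ((nbhd e g.1).card * (nbhd e g.2).card) := by ring
    -- (11/12)² - 1/4 = 85/144 ≥ 1/2.
    have h6 : δ ^ 2 ≤ 2 * (privateNbhd e Ω g).card := by omega
    have h7 : (δ : ℝ) ^ 2 ≤ 2 * (privateNbhd e Ω g).card := by exact_mod_cast h6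
    linarith
  have hout : ∀ h ∈ Ωᶜ, ∑ g ∈ Ω, ∑ x ∈ privateNbhd e Ω g, A x.1 h.1 * A x.2 h.2 ≤
      1 / 4 * (δ : ℝ) ^ 2 := by
    intro h hh
    -- The private neighbourhoods are disjoint and, as `h ∉ Ω`, all lie in `coveredBy e Ω h`; the
    -- weight of `h` there is its number of collisions.
    rw [← Finset.sum_biUnion fun g hg g' _ hne => disjoint_privateNbhd e hg hne]
    have hsub : Ω.biUnion (privateNbhd e Ω) ⊆ coveredBy e Ω h := by
      intro x hx
      obtain ⟨g, hg, hx⟩ := Finset.mem_biUnion.1 hx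
      rw [privateNbhd, Finset.mem_sdiff, Finset.mem_product] at hx
      refine mem_coveredBy.2 ⟨g, ?_, hg, hx.1⟩
      rintro rfl
      exact Finset.mem_compl.1 hh hg
    have hc : 4 * ((collisions e Ω h).card : ℝ) ≤ (δ : ℝ) ^ 2 := by exact_mod_cast hcol h
    calc _ ≤ ∑ x ∈ coveredBy e Ω h, A x.1 h.1 * A x.2 h.2 :=
          Finset.sum_le_sum_of_subset_of_nonneg hsub fun x _ _ => mul_nonneg (hA _ _) (hA _ _)
      _ ≤ ∑ x ∈ coveredBy e Ω h, multiAdj e x.1 h.1 * multiAdj e x.2 h.2 :=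
          Finset.sum_le_sum fun x _ =>
            mul_le_mul (hm _ _) (hm _ _) (hA _ _) ((hA _ _).trans (hm _ _))
      _ = _ := sum_multiAdj_coveredBy e Ω h
      _ ≤ _ := by linarith
  have key : 1 / 2 * (δ : ℝ) ^ 2 * ∑ g ∈ Ω, |V g.1 g.2| ≤
      1 / 4 * (δ : ℝ) ^ 2 * ∑ h ∈ Ωᶜ, |V h.1 h.2| := by
    calc _ = ∑ g ∈ Ω, 1 / 2 * (δ : ℝ) ^ 2 * |V g.1 g.2| := Finset.mul_sum _ _ _
      _ ≤ ∑ g ∈ Ω, ∑ x ∈ privateNbhd e Ω g, |V g.1 g.2| := by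
          refine Finset.sum_le_sum fun g _ => ?_
          rw [Finset.sum_const, nsmul_eq_mul]
          exact mul_le_mul_of_nonneg_right (hpriv g) (abs_nonneg _)
      _ ≤ ∑ g ∈ Ω, ∑ x ∈ privateNbhd e Ω g, ∑ h ∈ Ωᶜ, A x.1 h.1 * A x.2 h.2 * |V h.1 h.2| :=
          Finset.sum_le_sum fun g hg => Finset.sum_le_sum fun x hx =>
            abs_le_sum_compl_of_private hs hm hV hg hx
      _ = ∑ h ∈ Ωᶜ, (∑ g ∈ Ω, ∑ x ∈ privateNbhd e Ω g, A x.1 h.1 * A x.2 h.2) *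
            |V h.1 h.2| := by
          simp_rw [Finset.sum_mul]
          rw [Finset.sum_comm]
          exact Finset.sum_congr rfl fun g _ => Finset.sum_comm
      _ ≤ ∑ h ∈ Ωᶜ, 1 / 4 * (δ : ℝ) ^ 2 * |V h.1 h.2| :=
          Finset.sum_le_sum fun h hh =>
            mul_le_mul_of_nonneg_right (hout h hh) (abs_nonneg _)
      _ = _ := (Finset.mul_sum _ _ _).symm
  have h2 : ∑ g ∈ Ω, |V g.1 g.2| ≤ 1 / 2 * ∑ h ∈ Ωᶜ, |V h.1 h.2| := by
    refine le_of_mul_le_mul_left ?_ hδ'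
    linarith
  -- For ε = 1/5 the factor ε/(1 - 3ε) is 1/2.
  norm_num at h2 ⊢
  exact h2

/-! ### Exponential moments by resampling one vertex -/

/-- Summing over all functions is, up to the size of the codomain, summing over all functions and
all their modifications at one point. -/
theorem card_mul_sum_eq_sum_update {ι β : Type*} [Fintype ι] [DecidableEq ι] [Fintype β]
    (i : ι) (G : (ι → β) → ℕ) :
    Fintype.card β * ∑ e, G e = ∑ e : ι → β, ∑ x : β, G (Function.update e i x) := by
  classical
  rw [← Fintype.sum_prod_type' (f := fun (e : ι → β) x => G (Function.update e i x)), ← smul_eq_mul,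
    ← Finset.card_univ, ← Finset.sum_const, ← Fintype.sum_prod_type' (f := fun (_ : β) e => G e)]
  -- Exchanging the value at `i` with the spare value is a bijection.
  refine (Fintype.sum_equiv
    { toFun := fun y : (ι → β) × β => (y.1 i, Function.update y.1 i y.2)
      invFun := fun z => (Function.update z.2 i z.1, z.2 i)
      left_inv := fun y => by simp
      right_inv := fun z => by simp } _ _ fun y => rfl).symm

/-- The number of `k` with `x k ∈ T`. -/
def hits {m δ : ℕ} (x : Fin δ → Fin m) (T : Finset (Fin m)) : ℕ :=
  (Finset.univ.filter fun k => x k ∈ T).card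

/-- The moment factors over the independent coordinates, and each factor is at most c|T| + m ≤ 2m.
-/
theorem sum_pow_hits_le {m δ c : ℕ} (T : Finset (Fin m)) (hT : c * T.card ≤ m) :
    ∑ x : Fin δ → Fin m, c ^ hits x T ≤ (2 * m) ^ δ := by
  have h1 : ∀ x : Fin δ → Fin m, c ^ hits x T = ∏ k, if x k ∈ T then c else 1 := by
    intro x
    rw [Finset.prod_ite, Finset.prod_const, Finset.prod_const_one, mul_one, hits]
  simp_rw [h1]
  have h2 := Finset.prod_univ_sum (fun _ : Fin δ => (Finset.univ : Finset (Fin m)))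
    (fun _ y => if y ∈ T then c else 1)
  rw [Fintype.piFinset_univ] at h2
  rw [← h2, Finset.prod_const, Finset.card_univ, Fintype.card_fin]
  refine Nat.pow_le_pow_left ?_ δ
  calc ∑ y : Fin m, (if y ∈ T then c else 1) ≤ ∑ y : Fin m, ((if y ∈ T then c else 0) + 1) :=
        Finset.sum_le_sum fun y _ => by split_ifs <;> omega
    _ = c * T.card + m := by
        rw [Finset.sum_add_distrib]
        simp [mul_comm]
    _ ≤ 2 * m := by omega

/-- A bound for the exponential moment of the number of `k` for which `x k` lies in `S` or repeats
another value of `x`. -/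
theorem sum_pow_repeats_le {m c N : ℕ} (n : ℕ) (S : Finset (Fin m)) (hN : S.card + n ≤ N) :
    ∑ x : Fin n → Fin m, c ^ (n + S.card - (S ∪ Finset.univ.image x).card) ≤
      (m + c * N) ^ n := by
  induction n generalizing S with
  | zero => simp
  | succ n ih =>
    have hsplit : ∀ (a : Fin m) (x : Fin n → Fin m),
        S ∪ Finset.univ.image (Fin.cons a x : Fin (n + 1) → Fin m) =
          insert a S ∪ Finset.univ.image x := by
      intro a x
      ext y
      simp only [Finset.mem_union, Finset.mem_image, Finset.mem_univ, true_and,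
        Fin.exists_fin_succ, Fin.cons_zero, Fin.cons_succ, Finset.mem_insert]
      tauto
    rw [← Fintype.sum_equiv (Fin.consEquiv fun _ : Fin (n + 1) => Fin m)
      (fun y => c ^ (n + 1 + S.card -
        (insert y.1 S ∪ Finset.univ.image y.2).card)) _
      (fun y => by rw [← hsplit]; rfl), Fintype.sum_prod_type]
    -- Reveal the first value: if it lies in `S` it costs a factor `c` and leaves `S` unchanged;
    -- otherwise it joins `S`, which stays within the budget `N`.
    have hle : ∀ a : Fin m, ∑ x : Fin n → Fin m, c ^ (n + 1 + S.card -
        (insert a S ∪ Finset.univ.image x).card) ≤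
        ((if a ∈ S then c else 0) + 1) * (m + c * N) ^ n := by
      intro a
      by_cases ha : a ∈ S
      · have h := ih S (by omega)
        rw [if_pos ha, Finset.insert_eq_of_mem ha]
        refine le_trans ?_ (Nat.mul_le_mul (Nat.le_succ c) h)
        rw [Finset.mul_sum]
        refine Finset.sum_le_sum fun x _ => ?_
        have hc : (S ∪ Finset.univ.image x).card ≤ S.card + n :=
          (Finset.card_union_le _ _).trans (Nat.add_le_add_left
            (Finset.card_image_le.trans (by simp)) _)
        rw [← pow_succ']
        exact le_of_eq (congrArg _ (by omega))
      · have h := ih (insert a S) (by rw [Finset.card_insert_of_notMem ha]; omega)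
        rw [if_neg ha, zero_add, one_mul]
        rw [Finset.card_insert_of_notMem ha] at h
        refine le_trans (le_of_eq (Finset.sum_congr rfl fun x _ => congrArg _ ?_)) h
        omega
    refine (Finset.sum_le_sum fun a _ => hle a).trans ?_
    rw [← Finset.sum_mul, pow_succ']
    refine Nat.mul_le_mul_right _ ?_
    rw [Finset.sum_add_distrib]
    have : c * S.card ≤ c * N := Nat.mul_le_mul_left _ (by omega)
    simp only [Finset.sum_ite_mem, Finset.univ_inter, Finset.sum_const, smul_eq_mul, mul_one,
      Finset.card_univ, Fintype.card_fin]
    rw [mul_comm S.card]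
    omega

/-- The base of the exponential moments. -/
def base : ℕ := 512 ^ 12

/-- Markov's inequality for the exponential moment of a statistic of the edges at one vertex. -/
theorem card_filter_mul_le_of_moment {p m δ : ℕ} (hm : 0 < m) (i : Fin p)
    (G : EdgeChoice p m δ → ℕ)
    (hG : ∀ e, ∑ x : Fin δ → Fin m, base ^ G (Function.update e i x) ≤ (2 * m) ^ δ) :
    (Finset.univ.filter fun e => δ < 12 * G e).card * 256 ^ δ ≤
      Fintype.card (EdgeChoice p m δ) := by
  have h1 : Fintype.card (Fin δ → Fin m) * ∑ e, base ^ G e ≤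
      Fintype.card (EdgeChoice p m δ) * (2 * m) ^ δ := by
    rw [card_mul_sum_eq_sum_update i]
    refine (Finset.sum_le_sum fun e _ => hG e).trans ?_
    rw [Finset.sum_const, Finset.card_univ, smul_eq_mul]
  rw [Fintype.card_fun, Fintype.card_fin, Fintype.card_fin, mul_pow] at h1
  have h2 : ∑ e, base ^ G e ≤ Fintype.card (EdgeChoice p m δ) * 2 ^ δ := by
    refine Nat.le_of_mul_le_mul_left (h1.trans (le_of_eq ?_)) (pow_pos hm δ)
    ring
  have h3 : (Finset.univ.filter fun e => δ < 12 * G e).card * 512 ^ δ ≤ ∑ e, base ^ G e := by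
    rw [← smul_eq_mul]
    refine le_trans (Finset.card_nsmul_le_sum _ _ _ fun e he => ?_)
      (Finset.sum_le_sum_of_subset (Finset.filter_subset _ _))
    -- The exponent 12 in `base` matches the threshold δ/12: more than δ/12 occurrences contribute
    -- at least 512^δ, against a mean of at most 2^δ.
    rw [base, ← pow_mul]
    exact Nat.pow_le_pow_right (by norm_num) (Finset.mem_filter.1 he).2.le
  have h4 : 0 < 2 ^ δ := by positivity
  refine Nat.le_of_mul_le_mul_right (le_trans (le_of_eq ?_) (h3.trans h2)) h4
  rw [mul_assoc, ← mul_pow, show 256 * 2 = 512 from rfl]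

/-- The set `T` may be random, provided that it ignores the edges at `i`: this is conditioning on
all other vertices. -/
theorem card_many_hits_le {p m δ : ℕ} (hm : 0 < m) (i : Fin p)
    (T : EdgeChoice p m δ → Finset (Fin m)) (hT : ∀ e x, T (Function.update e i x) = T e)
    (hcard : ∀ e, base * (T e).card ≤ m) :
    (Finset.univ.filter fun e => δ < 12 * hits (e i) (T e)).card * 256 ^ δ ≤
      Fintype.card (EdgeChoice p m δ) := by
  refine card_filter_mul_le_of_moment hm i _ fun e => ?_
  simp only [hT, Function.update_self]
  exact sum_pow_hits_le (T e) (hcard e)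

theorem card_many_repeats_le {p m δ : ℕ} (hm : 0 < m) (i : Fin p) (h : base * δ ≤ m) :
    (Finset.univ.filter fun e : EdgeChoice p m δ => δ < 12 * (δ - (nbhd e i).card)).card *
      256 ^ δ ≤ Fintype.card (EdgeChoice p m δ) := by
  refine card_filter_mul_le_of_moment hm i _ fun e => ?_
  have := sum_pow_repeats_le (c := base) (N := δ) δ (∅ : Finset (Fin m)) (by simp)
  simp only [Finset.card_empty, Finset.empty_union, add_zero] at this
  simp only [nbhd, Function.update_self]
  exact this.trans (Nat.pow_le_pow_left (by omega) _)

/-! ### Traps that catch the collisions -/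

theorem nbhd_update {p m δ : ℕ} (e : EdgeChoice p m δ) (x : Fin δ → Fin m) {i a : Fin p}
    (h : a ≠ i) : nbhd (Function.update e i x) a = nbhd e a := by
  rw [nbhd, Function.update_of_ne h, nbhd]

/-- The right vertices adjacent to a member of `B`. -/
def ends {p m δ : ℕ} (e : EdgeChoice p m δ) (B : Finset (Fin p)) : Finset (Fin m) :=
  B.biUnion (nbhd e)

theorem ends_update {p m δ : ℕ} (e : EdgeChoice p m δ) (x : Fin δ → Fin m) {i : Fin p}
    {B : Finset (Fin p)} (h : i ∉ B) : ends (Function.update e i x) B = ends e B :=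
  Finset.biUnion_congr rfl fun a ha => nbhd_update e x (by rintro rfl; exact h ha)

theorem card_ends_le {p m δ : ℕ} (e : EdgeChoice p m δ) (B : Finset (Fin p)) :
    (ends e B).card ≤ B.card * δ :=
  Finset.card_biUnion_le_card_mul _ _ _ fun a _ => card_nbhd_le e a

/-- The left vertices other than `i` that share a column-`i'` element with `Ω`, and `i'`. -/
def colPartners {p : ℕ} (Ω : Finset (Fin p × Fin p)) (i i' : Fin p) : Finset (Fin p) :=
  (insert i' ((Ω.filter fun x => x.2 = i').image Prod.fst)).erase i

/-- The left vertices other than `i'` that share a row-`i` element with `Ω`, and `i`. -/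
def rowPartners {p : ℕ} (Ω : Finset (Fin p × Fin p)) (i i' : Fin p) : Finset (Fin p) :=
  (insert i ((Ω.filter fun x => x.1 = i).image Prod.snd)).erase i'

theorem card_colPartners_le {p d : ℕ} {Ω : Finset (Fin p × Fin p)} (hΩ : Ω ∈ distributedSets d p)
    (i i' : Fin p) : (colPartners Ω i i').card ≤ d + 1 :=
  (Finset.card_le_card (Finset.erase_subset _ _)).trans <| (Finset.card_insert_le _ _).trans <|
    Nat.add_le_add_right (Finset.card_image_le.trans (hΩ i').2) 1

theorem card_rowPartners_le {p d : ℕ} {Ω : Finset (Fin p × Fin p)} (hΩ : Ω ∈ distributedSets d p)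
    (i i' : Fin p) : (rowPartners Ω i i').card ≤ d + 1 :=
  (Finset.card_le_card (Finset.erase_subset _ _)).trans <| (Finset.card_insert_le _ _).trans <|
    Nat.add_le_add_right (Finset.card_image_le.trans (hΩ i).1) 1

theorem card_le_of_mem_distributedSets {p d : ℕ} {Ω : Finset (Fin p × Fin p)}
    (hΩ : Ω ∈ distributedSets d p) : Ω.card ≤ p * d := by
  rw [Finset.card_eq_sum_card_fiberwise (s := Ω) (t := Finset.univ) (f := Prod.fst) (by simp)]
  refine (Finset.sum_le_sum fun i _ => (hΩ i).1).trans ?_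
  simp

/-- The vertices of the tensor graph adjacent to an element of `Ω` with both coordinates different
from `i` and `i'`. -/
def far {p m δ : ℕ} (e : EdgeChoice p m δ) (Ω : Finset (Fin p × Fin p)) (i i' : Fin p) :
    Finset (Fin m × Fin m) :=
  (Ω.filter fun h => (h.1 ≠ i ∧ h.1 ≠ i') ∧ h.2 ≠ i ∧ h.2 ≠ i').biUnion
    fun h => nbhd e h.1 ×ˢ nbhd e h.2

theorem far_update {p m δ : ℕ} (e : EdgeChoice p m δ) (Ω : Finset (Fin p × Fin p))
    (x : Fin δ → Fin m) {i i' a : Fin p} (ha : a = i ∨ a = i') :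
    far (Function.update e a x) Ω i i' = far e Ω i i' := by
  refine Finset.biUnion_congr rfl fun h hh => ?_
  obtain ⟨-, ⟨h1, h2⟩, h3, h4⟩ := Finset.mem_filter.1 hh
  rcases ha with rfl | rfl
  · rw [nbhd_update e x h1, nbhd_update e x h3]
  · rw [nbhd_update e x h2, nbhd_update e x h4]

theorem card_far_le {p m δ d : ℕ} (e : EdgeChoice p m δ) {Ω : Finset (Fin p × Fin p)}
    (hΩ : Ω ∈ distributedSets d p) (i i' : Fin p) :
    (far e Ω i i').card ≤ p * d * δ ^ 2 := by
  refine (Finset.card_biUnion_le_card_mul _ _ (δ ^ 2) fun h _ => ?_).trans ?_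
  · rw [Finset.card_product, sq]
    exact Nat.mul_le_mul (card_nbhd_le e _) (card_nbhd_le e _)
  · exact Nat.mul_le_mul_right _ ((Finset.card_filter_le _ _).trans
      (card_le_of_mem_distributedSets hΩ))

/-- The section of `S` at `j`. -/
def slice {m : ℕ} (S : Finset (Fin m × Fin m)) (j : Fin m) : Finset (Fin m) :=
  Finset.univ.filter fun j' => (j, j') ∈ S

/-- The `j` at which the section of `S` is large. -/
def heavy {m : ℕ} (S : Finset (Fin m × Fin m)) : Finset (Fin m) :=
  Finset.univ.filter fun j => m < base * (slice S j).card

/-- Double counting: the sections partition `S`, and each heavy one has more than m/`base` elements.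
-/
theorem card_heavy_mul_le {m : ℕ} (S : Finset (Fin m × Fin m)) :
    (heavy S).card * m ≤ base * S.card := by
  have hS : S.card = ∑ j, (slice S j).card := by
    rw [Finset.card_eq_sum_card_fiberwise (s := S) (t := Finset.univ) (f := Prod.fst) (by simp)]
    refine Finset.sum_congr rfl fun j _ => ?_
    refine Finset.card_bij (fun x _ => x.2) ?_ ?_ ?_
    · rintro ⟨a, b⟩ h
      obtain ⟨h1, rfl⟩ := Finset.mem_filter.1 h
      simpa [slice] using h1
    · rintro ⟨a, b⟩ h ⟨a', b'⟩ h' heq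
      obtain ⟨-, rfl⟩ := Finset.mem_filter.1 h
      obtain ⟨-, h2⟩ := Finset.mem_filter.1 h'
      exact Prod.ext h2.symm heq
    · intro b hb
      exact ⟨(j, b), by simpa [slice] using hb, rfl⟩
  rw [hS, Finset.mul_sum, ← smul_eq_mul]
  refine le_trans (Finset.card_nsmul_le_sum _ _ _ fun j hj => ?_)
    (Finset.sum_le_sum_of_subset (Finset.subset_univ (heavy S)))
  exact (Finset.mem_filter.1 hj).2.le

/-- The set that few edges at `i` should hit. -/
def firstTrap {p m δ : ℕ} (Ω : Finset (Fin p × Fin p)) (i i' : Fin p) (e : EdgeChoice p m δ) :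
    Finset (Fin m) :=
  ends e (colPartners Ω i i') ∪ heavy (far e Ω i i')

/-- The set that few edges at `i'` should hit. -/
def secondTrap {p m δ : ℕ} (Ω : Finset (Fin p × Fin p)) (i i' : Fin p) (e : EdgeChoice p m δ) :
    Finset (Fin m) :=
  ends e (rowPartners Ω i i')

/-- The set that few edges at `i'` should hit, given an edge at `i` with the endpoint `e a l`. -/
def sliceTrap {p m δ : ℕ} (Ω : Finset (Fin p × Fin p)) (i i' a : Fin p) (l : Fin δ)
    (e : EdgeChoice p m δ) : Finset (Fin m) :=
  -- The endpoint is named by an edge at `a ≠ i'` because, when i = i', an edge at `i` would itself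
  -- be resampled. In the excluded cases the empty trap keeps the size bound trivial.
  if a ≠ i' ∧ e a l ∉ heavy (far e Ω i i') then slice (far e Ω i i') (e a l) else ∅

theorem firstTrap_update {p m δ : ℕ} (Ω : Finset (Fin p × Fin p)) (i i' : Fin p)
    (e : EdgeChoice p m δ) (x : Fin δ → Fin m) :
    firstTrap Ω i i' (Function.update e i x) = firstTrap Ω i i' e := by
  rw [firstTrap, ends_update e x (show i ∉ colPartners Ω i i' from Finset.notMem_erase _ _),
    far_update _ _ _ (Or.inl rfl), firstTrap]

theorem secondTrap_update {p m δ : ℕ} (Ω : Finset (Fin p × Fin p)) (i i' : Fin p)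
    (e : EdgeChoice p m δ) (x : Fin δ → Fin m) :
    secondTrap Ω i i' (Function.update e i' x) = secondTrap Ω i i' e :=
  ends_update _ _ (Finset.notMem_erase _ _)

theorem sliceTrap_update {p m δ : ℕ} (Ω : Finset (Fin p × Fin p)) (i i' a : Fin p) (l : Fin δ)
    (e : EdgeChoice p m δ) (x : Fin δ → Fin m) :
    sliceTrap Ω i i' a l (Function.update e i' x) = sliceTrap Ω i i' a l e := by
  by_cases ha : a = i'
  · simp [sliceTrap, ha]
  · rw [sliceTrap, far_update _ _ _ (Or.inr rfl), Function.update_of_ne ha, sliceTrap]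

/-- As d ≤ p, the scale √(dp) δ also dominates dδ, the size of a neighbourhood of d vertices. -/
theorem four_mul_base_mul_le {p m δ d : ℕ} (hdp : d ≤ p)
    (h : 16 * base ^ 2 * (d * p * δ ^ 2) ≤ m ^ 2) : 4 * (base * (d * δ)) ≤ m := by
  refine (Nat.pow_le_pow_iff_left two_ne_zero).1 ?_
  refine le_trans ?_ h
  calc (4 * (base * (d * δ))) ^ 2 = 16 * base ^ 2 * (d * d * δ ^ 2) := by ring
    _ ≤ _ := Nat.mul_le_mul_left _ (Nat.mul_le_mul_right _ (Nat.mul_le_mul_left _ hdp))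

theorem base_mul_card_ends_le {p m δ d : ℕ} (hd : 1 ≤ d) (hdp : d ≤ p)
    (h : 16 * base ^ 2 * (d * p * δ ^ 2) ≤ m ^ 2) (e : EdgeChoice p m δ) {B : Finset (Fin p)}
    (hB : B.card ≤ d + 1) : 2 * (base * (ends e B).card) ≤ m := by
  refine le_trans ?_ (four_mul_base_mul_le hdp h)
  calc 2 * (base * (ends e B).card) ≤ 2 * (base * (2 * d * δ)) :=
        Nat.mul_le_mul_left _ (Nat.mul_le_mul_left _ ((card_ends_le e B).trans
          (Nat.mul_le_mul_right _ (by omega))))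
    _ = _ := by ring

/-- One factor `base` comes from the definition of heavy, the other from the size allowed to a trap;
hence `base ^ 2` in the hypothesis. -/
theorem base_mul_card_heavy_far_le {p m δ d : ℕ} (hm : 0 < m)
    (h : 16 * base ^ 2 * (d * p * δ ^ 2) ≤ m ^ 2) (e : EdgeChoice p m δ)
    {Ω : Finset (Fin p × Fin p)} (hΩ : Ω ∈ distributedSets d p) (i i' : Fin p) :
    16 * (base * (heavy (far e Ω i i')).card) ≤ m := by
  refine Nat.le_of_mul_le_mul_right (le_trans ?_ (h.trans (sq m).le)) hm
  calc 16 * (base * (heavy (far e Ω i i')).card) * m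
      = 16 * base * ((heavy (far e Ω i i')).card * m) := by ring
    _ ≤ 16 * base * (base * (p * d * δ ^ 2)) :=
        Nat.mul_le_mul_left _ ((card_heavy_mul_le _).trans
          (Nat.mul_le_mul_left _ (card_far_le e hΩ i i')))
    _ = _ := by ring

theorem base_mul_card_sliceTrap_le {p m δ : ℕ} (Ω : Finset (Fin p × Fin p)) (i i' a : Fin p)
    (l : Fin δ) (e : EdgeChoice p m δ) : base * (sliceTrap Ω i i' a l e).card ≤ m := by
  rw [sliceTrap]
  split_ifs with h
  · simpa [heavy] using h.2
  · simp

/-- Let (a, b) ∈ Ω cause the collision. Unless a or b is a partner, neither belongs to {i, i'}, so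
the endpoint is a far pair: its first coordinate is heavy, or its second lies in a small section. -/
theorem collisions_subset {p m δ : ℕ} (e : EdgeChoice p m δ) (Ω : Finset (Fin p × Fin p))
    (i i' : Fin p) {k k' : Fin δ} (hk : (k, k') ∈ collisions e Ω (i, i')) :
    e i k ∈ firstTrap Ω i i' e ∨ e i' k' ∈ secondTrap Ω i i' e ∨
      ∃ a l, e a l = e i k ∧ e i' k' ∈ sliceTrap Ω i i' a l e := by
  obtain ⟨⟨a, b⟩, hne, hΩ, h1, h2⟩ := mem_coveredBy.1 (Finset.mem_filter.1 hk).2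
  simp only at h1 h2
  by_cases hcol : a ∈ colPartners Ω i i'
  · exact Or.inl (Finset.mem_union_left _ (Finset.mem_biUnion.2 ⟨a, hcol, h1⟩))
  by_cases hrow : b ∈ rowPartners Ω i i'
  · exact Or.inr (Or.inl (Finset.mem_biUnion.2 ⟨b, hrow, h2⟩))
  by_cases hh : e i k ∈ heavy (far e Ω i i')
  · exact Or.inl (Finset.mem_union_right _ hh)
  have hc : a ≠ i → a ≠ i' ∧ b ≠ i' := by
    intro hai
    refine ⟨?_, ?_⟩
    · rintro rfl
      exact hcol (by simp [colPartners, hai])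
    · rintro rfl
      exact hcol (by simp [colPartners, hai, hΩ])
  have hr : b ≠ i' → b ≠ i ∧ a ≠ i := by
    intro hbi
    refine ⟨?_, ?_⟩
    · rintro rfl
      exact hrow (by simp [rowPartners, hbi])
    · rintro rfl
      exact hrow (by simp [rowPartners, hbi, hΩ])
  -- If a = i, then b ≠ i' since (a, b) ≠ (i, i'), and so b would be a row partner.
  have hai : a ≠ i := by
    rintro rfl
    by_cases hb : b = i'
    · exact hne (by rw [hb])
    · exact (hr hb).2 rfl
  obtain ⟨hai', hbi'⟩ := hc hai
  obtain ⟨l, hl⟩ := mem_nbhd.1 h1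
  refine Or.inr (Or.inr ⟨a, l, hl, ?_⟩)
  rw [sliceTrap, if_pos ⟨hai', by rwa [hl]⟩, hl, slice]
  simp only [Finset.mem_filter, Finset.mem_univ, true_and]
  exact Finset.mem_biUnion.2 ⟨(a, b), by simp [hΩ, hai, hai', hbi', (hr hbi').1],
    Finset.mem_product.2 ⟨h1, h2⟩⟩

/-- Each of the three kinds of trap accounts for at most δ²/12 collisions. -/
theorem card_collisions_le {p m δ : ℕ} (e : EdgeChoice p m δ) (Ω : Finset (Fin p × Fin p))
    (i i' : Fin p) (h1 : 12 * hits (e i) (firstTrap Ω i i' e) ≤ δ)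
    (h2 : 12 * hits (e i') (secondTrap Ω i i' e) ≤ δ)
    (h3 : ∀ a l, 12 * hits (e i') (sliceTrap Ω i i' a l e) ≤ δ) :
    4 * (collisions e Ω (i, i')).card ≤ δ ^ 2 := by
  classical
  set X := (Finset.univ.filter fun k => e i k ∈ firstTrap Ω i i' e) ×ˢ
    (Finset.univ : Finset (Fin δ))
  set Y := (Finset.univ : Finset (Fin δ)) ×ˢ
    (Finset.univ.filter fun k' => e i' k' ∈ secondTrap Ω i i' e)
  set Z := (Finset.univ : Finset (Fin δ)).biUnion fun k => {k} ×ˢ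
    Finset.univ.filter fun k' => ∃ a l, e a l = e i k ∧ e i' k' ∈ sliceTrap Ω i i' a l e
  have hsub : collisions e Ω (i, i') ⊆ X ∪ (Y ∪ Z) := by
    rintro ⟨k, k'⟩ hk
    have := collisions_subset e Ω i i' hk
    simpa [X, Y, Z] using this
  have hX : X.card = hits (e i) (firstTrap Ω i i' e) * δ := by
    rw [Finset.card_product, Finset.card_univ, Fintype.card_fin, hits]
  have hY : Y.card = δ * hits (e i') (secondTrap Ω i i' e) := by
    rw [Finset.card_product, Finset.card_univ, Fintype.card_fin, hits]
  have hZ : Z.card ≤ δ * (δ / 12) := by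
    refine (Finset.card_biUnion_le_card_mul _ _ (δ / 12) fun k _ => ?_).trans (by simp)
    rw [Finset.card_product, Finset.card_singleton, one_mul]
    rcases Finset.eq_empty_or_nonempty (Finset.univ.filter fun k' =>
      ∃ a l, e a l = e i k ∧ e i' k' ∈ sliceTrap Ω i i' a l e) with h0 | ⟨k₀, hk₀⟩
    · rw [h0]
      exact Nat.zero_le _
    · obtain ⟨-, a, l, hal, hmem⟩ := Finset.mem_filter.1 hk₀
      -- A nonempty slice trap depends on (a, l) only through the endpoint `e a l = e i k`, so a
      -- single pair controls all of them.
      rw [Nat.le_div_iff_mul_le (by norm_num), mul_comm]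
      refine le_trans (Nat.mul_le_mul_left _ (Finset.card_le_card ?_)) (h3 a l)
      intro k' hk'
      obtain ⟨-, a', l', hal', hmem'⟩ := Finset.mem_filter.1 hk'
      refine Finset.mem_filter.2 ⟨Finset.mem_univ _, ?_⟩
      rw [sliceTrap] at hmem hmem' ⊢
      split_ifs at hmem hmem' ⊢
      · rwa [hal, ← hal']
      all_goals simp_all
  have hcard := (Finset.card_le_card hsub).trans ((Finset.card_union_le _ _).trans
    (Nat.add_le_add_left (Finset.card_union_le _ _) _))
  have h4 := Nat.mul_le_mul_right δ h1
  have h5 := Nat.mul_le_mul_left δ h2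
  have h6 : 12 * (δ * (δ / 12)) ≤ δ * δ := by
    rw [mul_left_comm]
    exact Nat.mul_le_mul_left _ (Nat.mul_div_le _ _)
  rw [hX, hY] at hcard
  rw [mul_assoc] at h4
  rw [mul_left_comm] at h5
  rw [sq]
  omega

/-! ### Union bound over the failures -/

/-- The union bound for counting. -/
theorem card_filter_exists_mul_le {ι α : Type*} [Fintype ι] [Fintype α] (P : ι → α → Prop)
    [∀ x, DecidablePred (P x)] [DecidablePred fun a => ∃ x, P x a] {M N : ℕ}
    (h : ∀ x, (Finset.univ.filter (P x)).card * M ≤ N) :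
    (Finset.univ.filter fun a => ∃ x, P x a).card * M ≤ Fintype.card ι * N := by
  classical
  have hsub : (Finset.univ.filter fun a => ∃ x, P x a) ⊆
      Finset.univ.biUnion fun x => Finset.univ.filter (P x) := by
    intro a ha
    simpa using ha
  refine (Nat.mul_le_mul_right M ((Finset.card_le_card hsub).trans Finset.card_biUnion_le)).trans ?_
  rw [Finset.sum_mul]
  refine (Finset.sum_le_sum fun x _ => h x).trans ?_
  simp

/-- The index set of the events in which the expansion may fail. -/
abbrev FailureIndex (p δ : ℕ) : Type :=
  Fin p ⊕ (Fin p × Fin p) ⊕ (Fin p × Fin p) ⊕ (Fin p × Fin p) × Fin p × Fin δ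

/-- The events in which the expansion may fail: a vertex has many repeated edges, or hits one of
its traps too often. -/
def Failure {p m δ : ℕ} (Ω : Finset (Fin p × Fin p)) :
    FailureIndex p δ → EdgeChoice p m δ → Prop
  | .inl i, e => δ < 12 * (δ - (nbhd e i).card)
  | .inr (.inl g), e => δ < 12 * hits (e g.1) (firstTrap Ω g.1 g.2 e)
  | .inr (.inr (.inl g)), e => δ < 12 * hits (e g.2) (secondTrap Ω g.1 g.2 e)
  | .inr (.inr (.inr (g, a, l))), e => δ < 12 * hits (e g.2) (sliceTrap Ω g.1 g.2 a l e)

open scoped Classical in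
theorem card_failure_mul_le {p m δ d : ℕ} (hm : 0 < m) (hd : 1 ≤ d) (hdp : d ≤ p)
    (h : 16 * base ^ 2 * (d * p * δ ^ 2) ≤ m ^ 2) {Ω : Finset (Fin p × Fin p)}
    (hΩ : Ω ∈ distributedSets d p) (x : FailureIndex p δ) :
    (Finset.univ.filter (Failure (m := m) Ω x)).card * 256 ^ δ ≤
      Fintype.card (EdgeChoice p m δ) := by
  rcases x with i | g | g | ⟨g, a, l⟩
  · have h1 := four_mul_base_mul_le hdp h
    have h2 : base * δ ≤ base * (d * δ) :=
      Nat.mul_le_mul_left _ (Nat.le_mul_of_pos_left _ hd)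
    convert card_many_repeats_le hm i (h2.trans (by omega)) using 4
    exact Iff.rfl
  · have key : ∀ e : EdgeChoice p m δ, base * (firstTrap Ω g.1 g.2 e).card ≤ m := by
      intro e
      have h1 := base_mul_card_ends_le hd hdp h e (card_colPartners_le hΩ g.1 g.2)
      have h2 := base_mul_card_heavy_far_le hm h e hΩ g.1 g.2
      have h3 := Nat.mul_le_mul_left base
        (Finset.card_union_le (ends e (colPartners Ω g.1 g.2)) (heavy (far e Ω g.1 g.2)))
      rw [mul_add] at h3
      exact h3.trans (by omega)
    convert card_many_hits_le hm g.1 _ (firstTrap_update Ω g.1 g.2) key using 4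
    exact Iff.rfl
  · have key : ∀ e : EdgeChoice p m δ, base * (secondTrap Ω g.1 g.2 e).card ≤ m := fun e =>
      le_trans (Nat.le_mul_of_pos_left _ two_pos)
        (base_mul_card_ends_le hd hdp h e (card_rowPartners_le hΩ g.1 g.2))
    convert card_many_hits_le hm g.2 _ (secondTrap_update Ω g.1 g.2) key using 4
    exact Iff.rfl
  · convert card_many_hits_le hm g.2 _ (sliceTrap_update Ω g.1 g.2 a l)
      (base_mul_card_sliceTrap_le Ω g.1 g.2 a l) using 4
    exact Iff.rfl

theorem nullspaceProperty_of_forall_not_failure {p m δ : ℕ} (hδ : 0 < δ)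
    {Ω : Finset (Fin p × Fin p)} {e : EdgeChoice p m δ} (h : ¬ ∃ x, Failure Ω x e)
    {A : Matrix (Fin m) (Fin p) ℝ} (hs : ∀ j i, simpleAdj e j i ≤ A j i)
    (hm : ∀ j i, A j i ≤ multiAdj e j i) : NullspaceProperty (1 / 5) Ω A := by
  rw [not_exists] at h
  refine nullspaceProperty_of_expansion hδ (fun i => ?_) (fun g => ?_) hs hm
  · have := not_lt.1 (h (.inl i))
    omega
  · exact card_collisions_le e Ω g.1 g.2 (not_lt.1 (h (.inr (.inl g))))
      (not_lt.1 (h (.inr (.inr (.inl g)))))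
      fun a l => not_lt.1 (h (.inr (.inr (.inr (g, a, l)))))

/-- Both p and δ are at most 2^δ, so the count is of order (2^δ)^5, below (2^δ)^8. The extra factor
p makes the failure probability smaller than 1/p. -/
theorem card_failureIndex_mul_lt {p δ : ℕ} (hδ : 0 < δ) (hp : p ≤ 2 ^ δ) :
    Fintype.card (FailureIndex p δ) * p < 256 ^ δ := by
  simp only [Fintype.card_sum, Fintype.card_prod, Fintype.card_fin]
  have hδ2 : δ < 2 ^ δ := Nat.lt_two_pow_self
  set b := 2 ^ δ with hb
  have hb2 : 2 ≤ b := by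
    calc 2 = 2 ^ 1 := rfl
      _ ≤ _ := Nat.pow_le_pow_right two_pos hδ
  have h256 : 256 ^ δ = b ^ 8 := by
    rw [hb, ← pow_mul, mul_comm, pow_mul]
    norm_num
  rw [h256]
  calc (p + (p * p + (p * p + p * p * (p * δ)))) * p
      ≤ (b + (b * b + (b * b + b * b * (b * b)))) * b := by gcongr
    _ = b ^ 2 + 2 * b ^ 3 + b ^ 5 := by ring
    _ < b ^ 8 := by
      have h2 : b ^ 2 ≤ b ^ 5 := Nat.pow_le_pow_right (by omega) (by norm_num)
      have h3 : b ^ 3 ≤ b ^ 5 := Nat.pow_le_pow_right (by omega) (by norm_num)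
      have h5 : 0 < b ^ 5 := by positivity
      have h8 : b ^ 5 * 2 ^ 3 ≤ b ^ 5 * b ^ 3 :=
        Nat.mul_le_mul_left _ (Nat.pow_le_pow_left hb2 3)
      rw [← pow_add, show 5 + 3 = 8 from rfl] at h8
      omega

/-- The nullspace property with high probability, with a natural-number hypothesis on `m`. -/
theorem one_sub_inv_lt_real_nullspaceProperty {p m δ d : ℕ} (hp : 0 < p) (hm : 0 < m)
    (hδ : 0 < δ) (hpδ : p ≤ 2 ^ δ) (hd : 1 ≤ d) (hdp : d ≤ p)
    (h : 16 * base ^ 2 * (d * p * δ ^ 2) ≤ m ^ 2) {Ω : Finset (Fin p × Fin p)}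
    (hΩ : Ω ∈ distributedSets d p) (A : EdgeChoice p m δ → Matrix (Fin m) (Fin p) ℝ)
    (hs : ∀ e j i, simpleAdj e j i ≤ A e j i) (hA : ∀ e j i, A e j i ≤ multiAdj e j i) :
    1 - (p : ℝ)⁻¹ < (randomGraph p m δ).real {e | NullspaceProperty (1 / 5) Ω (A e)} := by
  classical
  have := isProbabilityMeasure_randomGraph p m δ hm
  set F : Finset (EdgeChoice p m δ) := Finset.univ.filter fun e => ∃ x, Failure Ω x e
  set N := Fintype.card (EdgeChoice p m δ) with hN
  have hN0 : 0 < N := by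
    have : Nonempty (Fin m) := ⟨⟨0, hm⟩⟩
    exact Fintype.card_pos
  have hsub : {e | NullspaceProperty (1 / 5) Ω (A e)}ᶜ ⊆ (F : Set (EdgeChoice p m δ)) := by
    intro e he
    by_contra hF
    exact he (nullspaceProperty_of_forall_not_failure hδ (by simpa [F] using hF) (hs e) (hA e))
  have hF : F.card * p < N := by
    have h1 := card_filter_exists_mul_le (Failure Ω) (card_failure_mul_le hm hd hdp h hΩ)
    have h2 := card_failureIndex_mul_lt hδ hpδ
    have h3 : (F.card * p) * 256 ^ δ < N * 256 ^ δ := by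
      calc (F.card * p) * 256 ^ δ = F.card * 256 ^ δ * p := by ring
        _ ≤ Fintype.card (FailureIndex p δ) * N * p := Nat.mul_le_mul_right _ h1
        _ = N * (Fintype.card (FailureIndex p δ) * p) := by ring
        _ < N * 256 ^ δ := Nat.mul_lt_mul_of_pos_left h2 hN0
    exact Nat.lt_of_mul_lt_mul_right h3
  have hreal : (randomGraph p m δ).real (F : Set (EdgeChoice p m δ)) = F.card / N := by
    rw [MeasureTheory.measureReal_def, randomGraph, ProbabilityTheory.uniformOn_univ,
      MeasureTheory.Measure.count_apply_finset, ENNReal.toReal_div]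
    simp [hN]
  have hle := MeasureTheory.measureReal_mono (μ := randomGraph p m δ) hsub
  rw [MeasureTheory.probReal_compl_eq_one_sub (Set.toFinite _).measurableSet, hreal] at hle
  have hlt : (F.card : ℝ) / N < (p : ℝ)⁻¹ := by
    rw [div_lt_iff₀ (by exact_mod_cast hN0), inv_mul_eq_div, lt_div_iff₀ (by exact_mod_cast hp)]
    exact_mod_cast hF
  linarith

/-- Rows and columns have only p cells; this secures d ≤ p for the trap bounds. -/
theorem distributedSets_min {p d : ℕ} {Ω : Finset (Fin p × Fin p)}
    (hΩ : Ω ∈ distributedSets d p) : Ω ∈ distributedSets (min d p) p := by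
  intro i
  refine ⟨le_min (hΩ i).1 ?_, le_min (hΩ i).2 ?_⟩
  · rw [← Finset.card_image_of_injOn (f := Prod.snd)]
    · exact (Finset.card_le_univ _).trans (by simp)
    · rintro ⟨a, b⟩ h ⟨a', b'⟩ h' heq
      simp_all
  · rw [← Finset.card_image_of_injOn (f := Prod.fst)]
    · exact (Finset.card_le_univ _).trans (by simp)
    · rintro ⟨a, b⟩ h ⟨a', b'⟩ h' heq
      simp_all

end CovSketch

/-! ### Choice of the constants -/

theorem mainTheorem4 :
    ∃ ε : ℝ, 0 < ε ∧ ε < 1 / 4 ∧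
    ∃ c : ℝ, 0 < c ∧
    ∃ C₀ : ℝ, 0 < C₀ ∧
    ∀ C₁ : ℝ, C₀ ≤ C₁ →
    ∃ K : ℝ, 0 < K ∧
    ∀ p d δ m : ℕ, 2 ≤ p → 1 ≤ d →
      C₀ * Real.log p ≤ δ → (δ : ℝ) ≤ C₁ * Real.log p →
      K * (Real.sqrt ((d : ℝ) * p) * Real.log p) ≤ m →
      ∀ Ω ∈ CovSketch.distributedSets d p,
        1 - (p : ℝ) ^ (-c) < (CovSketch.randomGraph p m δ).real
            {e | CovSketch.NullspaceProperty ε Ω (CovSketch.multiAdj e)} ∧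
        1 - (p : ℝ) ^ (-c) < (CovSketch.randomGraph p m δ).real
            {e | CovSketch.NullspaceProperty ε Ω (CovSketch.simpleAdj e)} := by
  refine ⟨1 / 5, by norm_num, by norm_num, 1, one_pos, 2, two_pos, fun C₁ hC₁ =>
    ⟨4 * CovSketch.base * C₁, ?_, ?_⟩⟩
  · have : 0 < CovSketch.base := by norm_num [CovSketch.base]
    positivity
  intro p d δ m hp hd hδ₀ hδ₁ hm Ω hΩ
  have hbase : (0 : ℝ) < CovSketch.base := by
    exact_mod_cast (show 0 < CovSketch.base by norm_num [CovSketch.base])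
  have hp1 : (1 : ℝ) < p := by exact_mod_cast hp
  have hlog : 0 < Real.log p := Real.log_pos hp1
  have hδ : 0 < δ := by
    have : (0 : ℝ) < δ := by linarith
    exact_mod_cast this
  -- C₀ = 2 suffices because log 2 > 1/2.
  have hpδ : p ≤ 2 ^ δ := by
    have h1 : Real.log p ≤ Real.log ((2 : ℝ) ^ δ) := by
      rw [Real.log_pow]
      have := Real.log_two_gt_d9
      nlinarith
    have h2 := (Real.log_le_log_iff (by linarith) (by positivity)).1 h1
    exact_mod_cast h2
  -- K = 4 `base` C₁ absorbs δ ≤ C₁ log p; squaring yields the hypothesis on m².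
  have hmδ : 4 * (CovSketch.base : ℝ) * (Real.sqrt ((d : ℝ) * p) * δ) ≤ m := by
    refine le_trans ?_ hm
    calc 4 * (CovSketch.base : ℝ) * (Real.sqrt ((d : ℝ) * p) * δ)
        ≤ 4 * (CovSketch.base : ℝ) * (Real.sqrt ((d : ℝ) * p) * (C₁ * Real.log p)) := by gcongr
      _ = _ := by ring
  have hm0 : 0 < m := by
    have h1 : (0 : ℝ) < 4 * (CovSketch.base : ℝ) * (Real.sqrt ((d : ℝ) * p) * δ) := by
      have : (0 : ℝ) < d := by exact_mod_cast hd
      have : (0 : ℝ) < δ := by exact_mod_cast hδ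
      positivity
    exact_mod_cast h1.trans_le hmδ
  have hsq : 16 * CovSketch.base ^ 2 * (min d p * p * δ ^ 2) ≤ m ^ 2 := by
    have h1 : 16 * CovSketch.base ^ 2 * (d * p * δ ^ 2) ≤ m ^ 2 := by
      have h2 := pow_le_pow_left₀ (by positivity) hmδ 2
      rw [mul_pow, mul_pow _ (δ : ℝ), Real.sq_sqrt (by positivity), mul_pow] at h2
      norm_num at h2
      exact_mod_cast h2
    refine le_trans ?_ h1
    gcongr
    exact min_le_left _ _
  have hmain := CovSketch.one_sub_inv_lt_real_nullspaceProperty (by omega) hm0 hδ hpδ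
    (le_min hd (by omega)) (min_le_right d p) hsq (CovSketch.distributedSets_min hΩ)
  rw [Real.rpow_neg_one]
  exact ⟨hmain CovSketch.multiAdj CovSketch.simpleAdj_le_multiAdj fun _ _ _ => le_rfl,
    hmain CovSketch.simpleAdj (fun _ _ _ => le_rfl) CovSketch.simpleAdj_le_multiAdj⟩
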